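/- Let $S$ be a finite set and let $\mu: S\times S\to\mathbf R_{\ge 0}$ be a directed distance on $S$, i.e. $\mu(s,s)=0$ for all $s\in S$ (neither symmetry nor the triangle inequality is assumed). Let $S^c=\{s^c: s\in S\}$ and $S^r=\{s^r : s\in S\}$ be two disjoint copies of $S$, and let $$P_\mu=\{p\in\mathbf R_{\ge 0}^{S^c\cup S^r} : p(s^c)+p(t^r)\ge \mu(s,t)\ \text{ for all } s,t\in S\}.$$ The directed tight span $T_\mu$ is the set of minimal elements of $P_\mu$ in the coordinatewise order. It is a union of faces of the polyhedron $P_\mu$, and $\dim T_\mu$ denotes the largest dimension of a face of $P_\mu$ contained in $T_\mu$. An oriented tree is a finite directed graph $\Gamma$ whose underlying undirected graph is a tree. Given positive edge lengths $\alpha$ on $\Gamma$ and vertices $x,y$ of $\Gamma$, let $D_{\Gamma,\alpha}(x,y)$ be the sum of $\alpha(e)$ over those edges $e$ on the unique undirected path between $x$ and $y$ that are oriented in the direction from $x$ to $y$. A subtree of $\Gamma$ is a (nonempty) subgraph whose underlying undirected graph is connected, and for subtrees $F,F'$ put $D_{\Gamma,\alpha}(F,F')=\min\{D_{\Gamma,\alpha}(x,y):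 x\in F,\ y\in F'\}$, the minimum being over vertices. An oriented-tree realization of $\mu$ is a triple $(\Gamma,\alpha;\{F_s\}_{s\in S})$ of an oriented tree $\Gamma$, a positive edge length $\alpha$ and a family of subtrees $F_s$ of $\Gamma$ such that $\mu(s,t)=D_{\Gamma,\alpha}(F_s,F_t)$ for all $s,t\in S$. A directed path is an oriented tree in which every vertex has at most one leaving edge and at most one entering edge. **Theorem.** The following conditions are equivalent: (a) $\mu$ has an oriented-tree realization $(\Gamma,\alpha;\{F_s\}_{s\in S})$ such that $\Gamma$ is a directed path; (b) $\dim T_\mu\le 1$; (c) for all $s,t,u,v\in S$ (not necessarily distinct), $$\mu(s,u)+\mu(t,v)\le\max\{\mu(s,v)+\mu(t,u),\ \mu(s,u),\ \mu(s,v),\ \mu(t,u),\ \mu(t,v)\}.$$ -/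

import Mathlib

/-- A directed distance on `S`: a nonnegative function on ordered pairs with zero diagonal
(no symmetry and no triangle inequality). -/
structure IsDirectedDistance {S : Type*} (μ : S → S → ℝ) : Prop where
  nonneg : ∀ s t, 0 ≤ μ s t
  diag : ∀ s, μ s s = 0

namespace DirectedDistance

/-- The polyhedron `P_μ` in `ℝ^(S^c ∪ S^r)`. The copy `s^c` of `s` is `Sum.inl s`,
the copy `s^r` is `Sum.inr s`. -/
def polyhedronP {S : Type*} (μ : S → S → ℝ) : Set (S ⊕ S → ℝ) :=
  {p | (∀ s t, μ s t ≤ p (Sum.inl s) + p (Sum.inr t)) ∧ ∀ u, 0 ≤ p u}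

/-- The directed tight span `T_μ`: the minimal elements of `P_μ` for the coordinatewise order. -/
def tightSpan {S : Type*} (μ : S → S → ℝ) : Set (S ⊕ S → ℝ) :=
  {p | Minimal (· ∈ polyhedronP μ) p}

/-- The faces of the polyhedral complex `T_μ`: the nonempty faces of the polyhedron `P_μ` that are
contained in `T_μ`. (A nonempty face of a polyhedron is the set of maximizers of some linear
functional on it; the whole polyhedron is obtained from the zero functional.) -/
def tightSpanFaces {S : Type*} (μ : S → S → ℝ) : Set (Set (S ⊕ S → ℝ)) :=
  {F | F.Nonempty ∧ IsExposed ℝ (polyhedronP μ) F ∧ F ⊆ tightSpan μ}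

/-- `dim T_μ`: the maximum dimension of a face of `T_μ`, where the dimension of a face is the
dimension of its affine span. -/
noncomputable def tightSpanDim {S : Type*} (μ : S → S → ℝ) : ℕ∞ :=
  ⨆ F ∈ tightSpanFaces μ, (Module.finrank ℝ (affineSpan ℝ F).direction : ℕ∞)

/-- An oriented tree: a directed graph, with no two opposite edges and no loops, whose underlying
undirected graph is a tree. -/
structure OrientedTree (V : Type*) where
  /-- the directed graph; `graph.Adj x y` means that there is an edge with tail `x`, head `y` -/
  graph : Digraph V
  asymm : ∀ x y, graph.Adj x y → ¬ graph.Adj y x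
  isTree : graph.toSimpleGraphInclusive.IsTree

namespace OrientedTree

variable {V : Type*}

/-- The underlying undirected tree. -/
abbrev underlying (Γ : OrientedTree V) : SimpleGraph V := Γ.graph.toSimpleGraphInclusive

/-- The unique path from `x` to `y` in the underlying undirected tree. -/
noncomputable def path (Γ : OrientedTree V) (x y : V) : Γ.underlying.Walk x y :=
  (Γ.isTree.existsUnique_path x y).choose

open Classical in
/-- The directed metric `D_{Γ,α}`: the total length of those edges on the path from `x` to `y`
whose orientation agrees with the direction from `x` to `y`. -/
noncomputable def dist (Γ : OrientedTree V) (α : V → V → ℝ) (x y : V) : ℝ :=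
  ((Γ.path x y).darts.map fun e => if Γ.graph.Adj e.fst e.snd then α e.fst e.snd else 0).sum

/-- The shortest distance from a vertex set `A` to a vertex set `B`. -/
noncomputable def setDist (Γ : OrientedTree V) (α : V → V → ℝ) (A B : Set V) : ℝ :=
  sInf {r | ∃ x ∈ A, ∃ y ∈ B, r = Γ.dist α x y}

/-- A directed path: every vertex has at most one leaving edge and at most one entering edge. -/
def IsDirectedPath (Γ : OrientedTree V) : Prop :=
  (∀ x y z, Γ.graph.Adj x y → Γ.graph.Adj x z → y = z) ∧
    (∀ x y z, Γ.graph.Adj y x → Γ.graph.Adj z x → y = z)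

end OrientedTree

/-- An oriented-tree realization of `μ` with vertex set `V`: an oriented tree, a positive length for
every edge, and a family of subtrees (connected, hence nonempty, subgraphs; the edges of a subgraph
inherit the orientation of the tree) with `μ s t = D(F_s, F_t)`. -/
structure OrientedTreeRealization {S : Type*} (μ : S → S → ℝ) (V : Type*) where
  tree : OrientedTree V
  /-- the edge length; only the values `len x y` at edges `xy` matter -/
  len : V → V → ℝ
  len_pos : ∀ x y, tree.graph.Adj x y → 0 < len x y
  subtree : S → tree.underlying.Subgraph
  connected : ∀ s, (subtree s).Connected
  realizes : ∀ s t, μ s t = tree.setDist len (subtree s).verts (subtree t).verts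

end DirectedDistance

/-!
Realizability by a directed path and the bound on `dim T_μ` are each shown to be equivalent to the
four-point condition, `FourPointCondition`.

On a directed path the metric is `D(x, y) = max 0 (φ y - φ x)` for a potential `φ` with increment
`α(e)` along every edge `e` (`OrientedTree.IsDirectedPath.dist_eq`). Hence, if `μ(s,u)` and `μ(t,v)`
are positive, both are bounded by differences of `φ` between end points of shortest connections for
`μ(s,v)` and `μ(t,u)`, and the two differences regroup to `μ(s,v) + μ(t,u)`
(`OrientedTreeRealization.fourPointCondition`). Conversely, let `(s₀, u₀)` maximize `μ` and let `M`
be the maximum. Two instances of the four-point condition give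
`μ(s,t) = max 0 (μ(s₀,t) + μ(s,u₀) - M)`, so that `μ` is the directed distance between real
intervals (`FourPointCondition.exists_intervals`), and the end points of the intervals are the
vertices of a directed path (`exists_realization_of_intervals`).

A point `p` of `P_μ` lies in `T_μ` if and only if every coordinate occurs in an inequality that is
tight at `p` (`mem_tightSpan_iff`), and a face of `T_μ` is governed by the tight inequalities at one
of its relative interior points. Under the four-point condition, any two tight pairs `(s,u)`,
`(t,v)` with positive coordinates are linked by a third one, so a direction of the face is
determined by one coordinate and the face has dimension at most one
(`FourPointCondition.tightSpanDim_le_one`). If the condition fails at `s, t, u, v`, the values at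
`s^c, t^c` of the points of `T_μ` with `p(s^c) + p(u^r) = μ(s,u)` and `p(t^c) + p(v^r) = μ(t,v)`
fill a plane region with nonempty interior, which contains an arc of a parabola. Finitely many faces
of dimension at most one project to a finite union of subsets of lines, which cannot cover the arc
(`fourPointCondition_of_tightSpanDim_le_one`).
-/

namespace DirectedDistance

open Topology Filter

/-- The four-point condition that characterizes directed distances realized by
directed paths. -/
def FourPointCondition {S : Type*} (μ : S → S → ℝ) : Prop :=
  ∀ s t u v : S, μ s u + μ t v ≤
    max (μ s v + μ t u) (max (μ s u) (max (μ s v) (max (μ t u) (μ t v))))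

section TightSpan

variable {S : Type*}

/-! ### Tight constraints of the polyhedron -/

/-- The left-hand sides of the inequalities that define `P_μ`: `p ↦ p(s^c) + p(t^r)` for a pair
`(s, t)`, and the coordinate `p ↦ p u` for an element `u` of `S^c ∪ S^r`. -/
def constraintForm : (S × S) ⊕ (S ⊕ S) → StrongDual ℝ (S ⊕ S → ℝ) :=
  Sum.elim
    (fun e => ContinuousLinearMap.proj (R := ℝ) (φ := fun _ : S ⊕ S => ℝ) (Sum.inl e.1) +
      ContinuousLinearMap.proj (Sum.inr e.2))
    (fun u => ContinuousLinearMap.proj u)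

/-- The right-hand sides of the inequalities that define `P_μ`. -/
def constraintBound (μ : S → S → ℝ) : (S × S) ⊕ (S ⊕ S) → ℝ :=
  Sum.elim (fun e => μ e.1 e.2) (fun _ => 0)

/-- The inequalities of `P_μ` that hold with equality at `p`. -/
def tightConstraints (μ : S → S → ℝ) (p : S ⊕ S → ℝ) : Set ((S × S) ⊕ (S ⊕ S)) :=
  {c | constraintForm c p = constraintBound μ c}

@[simp]
lemma constraintForm_inl (e : S × S) (p : S ⊕ S → ℝ) :
    constraintForm (Sum.inl e) p = p (Sum.inl e.1) + p (Sum.inr e.2) := rfl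

@[simp]
lemma constraintForm_inr (u : S ⊕ S) (p : S ⊕ S → ℝ) : constraintForm (Sum.inr u) p = p u := rfl

lemma mem_polyhedronP_iff {μ : S → S → ℝ} {p : S ⊕ S → ℝ} :
    p ∈ polyhedronP μ ↔ ∀ c, constraintBound μ c ≤ constraintForm c p := by
  rw [Sum.forall, Prod.forall]
  rfl

lemma constraintForm_mono (c : (S × S) ⊕ (S ⊕ S)) {x y : S ⊕ S → ℝ} (h : x ≤ y) :
    constraintForm c x ≤ constraintForm c y := by
  rcases c with e | u
  · exact add_le_add (h _) (h _)
  · exact h u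

lemma convex_polyhedronP (μ : S → S → ℝ) : Convex ℝ (polyhedronP μ) := by
  intro x hx y hy a b ha hb hab
  rw [mem_polyhedronP_iff] at *
  intro c
  rw [map_add, map_smul, map_smul, smul_eq_mul, smul_eq_mul]
  calc constraintBound μ c = a * constraintBound μ c + b * constraintBound μ c := by
        rw [← add_mul, hab, one_mul]
    _ ≤ _ := add_le_add (mul_le_mul_of_nonneg_left (hx c) ha) (mul_le_mul_of_nonneg_left (hy c) hb)

lemma isClosed_polyhedronP (μ : S → S → ℝ) : IsClosed (polyhedronP μ) := by
  have : polyhedronP μ = ⋂ c, {p | constraintBound μ c ≤ constraintForm c p} := by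
    ext p
    simp only [mem_polyhedronP_iff, Set.mem_iInter, Set.mem_ofPred_eq]
  rw [this]
  exact isClosed_iInter fun c => isClosed_le continuous_const (constraintForm c).continuous

/-- Two tight pairs with positive coordinates are joined by a further tight pair. -/
lemma FourPointCondition.tight_or_tight {μ : S → S → ℝ} (h : FourPointCondition μ)
    {p : S ⊕ S → ℝ} (hp : p ∈ polyhedronP μ) {s t u v : S}
    (hs : 0 < p (Sum.inl s)) (hu : 0 < p (Sum.inr u))
    (ht : 0 < p (Sum.inl t)) (hv : 0 < p (Sum.inr v))
    (hsu : p (Sum.inl s) + p (Sum.inr u) = μ s u)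
    (htv : p (Sum.inl t) + p (Sum.inr v) = μ t v) :
    p (Sum.inl s) + p (Sum.inr v) = μ s v ∨ p (Sum.inl t) + p (Sum.inr u) = μ t u := by
  by_contra! hne
  have h1 := lt_of_le_of_ne (hp.1 s v) hne.1.symm
  have h2 := lt_of_le_of_ne (hp.1 t u) hne.2.symm
  refine (h s t u v).not_gt ?_
  simp only [max_lt_iff]
  refine ⟨?_, ?_, ?_, ?_, ?_⟩ <;> linarith

variable [Finite S]

open Classical in
/-- A point of `P_μ` is minimal if and only if no coordinate can be lowered, that is, every
coordinate occurs in a tight inequality. -/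
lemma mem_tightSpan_iff {μ : S → S → ℝ} {p : S ⊕ S → ℝ} :
    p ∈ tightSpan μ ↔ p ∈ polyhedronP μ ∧
      ∀ u, ∃ c ∈ tightConstraints μ p, 0 < constraintForm c (Pi.single u 1) := by
  constructor
  · intro hp
    refine ⟨hp.1, fun u => ?_⟩
    by_contra! h
    have hP := mem_polyhedronP_iff.1 hp.1
    have key : ∀ᶠ ε : ℝ in 𝓝[>] 0, ∀ c,
        constraintBound μ c ≤ constraintForm c (p - ε • Pi.single u 1) := by
      rw [eventually_all]
      intro c
      by_cases hc : c ∈ tightConstraints μ p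
      · filter_upwards [self_mem_nhdsWithin] with ε hε
        rw [map_sub, map_smul, smul_eq_mul]
        have := mul_nonpos_of_nonneg_of_nonpos (le_of_lt hε) (h c hc)
        linarith [hP c]
      · have hlt : constraintBound μ c < constraintForm c (p - (0 : ℝ) • Pi.single u 1) := by
          rw [zero_smul, sub_zero]
          exact lt_of_le_of_ne (hP c) (Ne.symm hc)
        have hcont : Continuous fun ε : ℝ => constraintForm c (p - ε • Pi.single u (1 : ℝ)) := by
          fun_prop
        exact ((hcont.tendsto 0).eventually_const_le hlt).filter_mono nhdsWithin_le_nhds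
    obtain ⟨ε, hε, hε0⟩ := (key.and self_mem_nhdsWithin).exists
    have hε0 : 0 < ε := hε0
    have hle : p - ε • Pi.single u 1 ≤ p :=
      sub_le_self _ (smul_nonneg hε0.le (Pi.single_nonneg.2 zero_le_one))
    have := hp.2 (mem_polyhedronP_iff.2 hε) hle u
    simp at this
    linarith
  · rintro ⟨hP, h⟩
    refine ⟨hP, fun y hy hyp u => ?_⟩
    obtain ⟨c, hc, hpos⟩ := h u
    have hle : (p u - y u) • Pi.single u 1 ≤ p - y := by
      intro w
      rcases eq_or_ne w u with rfl | hw
      · simp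
      · simpa [hw] using hyp w
    have h1 := constraintForm_mono c hle
    have h2 := mem_polyhedronP_iff.1 hy c
    have h3 : constraintForm c p = constraintBound μ c := hc
    rw [map_sub, map_smul, smul_eq_mul] at h1
    have : p u - y u ≤ 0 := nonpos_of_mul_nonpos_left (by linarith) hpos
    linarith

lemma tightSpan_of_tightConstraints_subset {μ : S → S → ℝ} {p x : S ⊕ S → ℝ}
    (hp : p ∈ tightSpan μ) (hx : x ∈ polyhedronP μ)
    (h : tightConstraints μ p ⊆ tightConstraints μ x) : x ∈ tightSpan μ := by
  classical
  rw [mem_tightSpan_iff] at *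
  refine ⟨hx, fun u => ?_⟩
  obtain ⟨c, hc, hpos⟩ := hp.2 u
  exact ⟨c, h hc, hpos⟩

lemma exists_tight_pair_of_pos_inl {μ : S → S → ℝ} {p : S ⊕ S → ℝ} (hp : p ∈ tightSpan μ) {s : S}
    (hs : 0 < p (Sum.inl s)) : ∃ t, p (Sum.inl s) + p (Sum.inr t) = μ s t := by
  classical
  obtain ⟨c, hc, hpos⟩ := (mem_tightSpan_iff.1 hp).2 (Sum.inl s)
  rcases c with ⟨a, b⟩ | u
  · have : a = s := by
      by_contra hne
      simp [hne] at hpos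
    subst this
    exact ⟨b, hc⟩
  · have : u = Sum.inl s := by
      by_contra hne
      simp [hne] at hpos
    subst this
    exact absurd hc hs.ne'

lemma exists_tight_pair_of_pos_inr {μ : S → S → ℝ} {p : S ⊕ S → ℝ} (hp : p ∈ tightSpan μ) {t : S}
    (ht : 0 < p (Sum.inr t)) : ∃ s, p (Sum.inl s) + p (Sum.inr t) = μ s t := by
  classical
  obtain ⟨c, hc, hpos⟩ := (mem_tightSpan_iff.1 hp).2 (Sum.inr t)
  rcases c with ⟨a, b⟩ | u
  · have : b = t := by
      by_contra hne
      simp [hne] at hpos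
    subst this
    exact ⟨a, hc⟩
  · have : u = Sum.inr t := by
      by_contra hne
      simp [hne] at hpos
    subst this
    exact absurd hc ht.ne'

/-- The points of `P_μ` at which all inequalities tight at `p ∈ T_μ` are tight form a face of
`T_μ`. -/
lemma setOf_tightConstraints_subset_mem_tightSpanFaces {μ : S → S → ℝ} {p : S ⊕ S → ℝ}
    (hp : p ∈ tightSpan μ) :
    {x ∈ polyhedronP μ | tightConstraints μ p ⊆ tightConstraints μ x} ∈ tightSpanFaces μ := by
  classical
  have := Fintype.ofFinite S
  refine ⟨⟨p, hp.1, subset_rfl⟩, fun _ => ?_,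
    fun x hx => tightSpan_of_tightConstraints_subset hp hx.1 hx.2⟩
  -- the face is cut out by minus the sum of the forms that are tight at `p`
  refine ⟨-∑ c with c ∈ tightConstraints μ p, constraintForm c, ?_⟩
  ext x
  simp only [Set.mem_ofPred_eq, neg_apply, sum_apply,
    neg_le_neg_iff, and_congr_right_iff]
  intro hx
  constructor
  · intro h y hy
    refine Finset.sum_le_sum fun c hc => ?_
    rw [show constraintForm c x = _ from h (Finset.mem_filter.1 hc).2]
    exact mem_polyhedronP_iff.1 hy c
  · intro h
    have h1 := h p hp.1
    have h2 : ∀ c ∈ Finset.univ.filter (· ∈ tightConstraints μ p),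
        constraintForm c p ≤ constraintForm c x := fun c hc => by
      rw [show constraintForm c p = _ from (Finset.mem_filter.1 hc).2]
      exact mem_polyhedronP_iff.1 hx c
    have h3 := (Finset.sum_eq_sum_iff_of_le h2).1 (le_antisymm (Finset.sum_le_sum h2) h1)
    intro c hc
    have hc' : constraintForm c p = constraintBound μ c := hc
    exact (h3 c (by simpa using hc)).symm.trans hc'

/-- Every point of `P_μ` lies above a point of `T_μ`. -/
lemma exists_mem_tightSpan_le {μ : S → S → ℝ} {q : S ⊕ S → ℝ} (hq : q ∈ polyhedronP μ) :
    ∃ p ∈ tightSpan μ, p ≤ q := by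
  have := Fintype.ofFinite S
  have hK : IsCompact (Set.Icc 0 q ∩ polyhedronP μ) :=
    isCompact_Icc.inter_right (isClosed_polyhedronP μ)
  obtain ⟨p, hp, hmin⟩ := hK.exists_isMinOn (f := fun p => ∑ u, p u) ⟨q, ⟨hq.2, le_rfl⟩, hq⟩
    (by fun_prop)
  refine ⟨p, ⟨hp.2, fun y hy hyp u => ?_⟩, hp.1.2⟩
  have h1 : ∑ u, p u ≤ ∑ u, y u := hmin ⟨⟨hy.2, hyp.trans hp.1.2⟩, hy⟩
  have h2 := (Finset.sum_eq_sum_iff_of_le fun u _ => hyp u).1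
    (le_antisymm (Finset.sum_le_sum fun u _ => hyp u) h1)
  exact (h2 u (Finset.mem_univ u)).ge

/-! ### The four-point condition and the dimension of the tight span -/

/-- Under the four-point condition all components of the graph of tight pairs with positive
coordinates coincide, so the directions orthogonal to the tight constraints at `p` are determined
by a single coordinate. -/
lemma FourPointCondition.exists_functional {μ : S → S → ℝ} (h : FourPointCondition μ)
    {p : S ⊕ S → ℝ} (hp : p ∈ tightSpan μ) :
    ∃ f : (S ⊕ S → ℝ) →ₗ[ℝ] ℝ, ∀ d : S ⊕ S → ℝ,
      (∀ c ∈ tightConstraints μ p, constraintForm c d = 0) → f d = 0 → d = 0 := by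
  have hzero : ∀ d : S ⊕ S → ℝ, (∀ c ∈ tightConstraints μ p, constraintForm c d = 0) →
      ∀ u, ¬ 0 < p u → d u = 0 := fun d hd u hu =>
    hd (Sum.inr u) (le_antisymm (not_lt.1 hu) (hp.1.2 u))
  have hpair : ∀ d : S ⊕ S → ℝ, (∀ c ∈ tightConstraints μ p, constraintForm c d = 0) →
      ∀ s t, p (Sum.inl s) + p (Sum.inr t) = μ s t → d (Sum.inl s) + d (Sum.inr t) = 0 :=
    fun d hd s t hst => hd (Sum.inl (s, t)) hst
  -- it is enough to treat the coordinates of tight pairs with positive coordinates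
  have hred : ∀ d : S ⊕ S → ℝ, (∀ c ∈ tightConstraints μ p, constraintForm c d = 0) →
      (∀ s t, 0 < p (Sum.inl s) → 0 < p (Sum.inr t) → p (Sum.inl s) + p (Sum.inr t) = μ s t →
        d (Sum.inl s) = 0) → d = 0 := by
    intro d hd hfree
    funext u
    by_cases hu : 0 < p u
    swap
    · exact hzero d hd u hu
    rcases u with s | t
    · obtain ⟨t, hst⟩ := exists_tight_pair_of_pos_inl hp hu
      by_cases ht : 0 < p (Sum.inr t)
      · exact hfree s t hu ht hst
      · have := hpair d hd s t hst
        rwa [hzero d hd _ ht, add_zero] at this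
    · obtain ⟨s, hst⟩ := exists_tight_pair_of_pos_inr hp hu
      have := hpair d hd s t hst
      by_cases hs : 0 < p (Sum.inl s)
      · rwa [hfree s t hs hu hst, zero_add] at this
      · rwa [hzero d hd _ hs, zero_add] at this
  by_cases hex : ∃ s t, 0 < p (Sum.inl s) ∧ 0 < p (Sum.inr t) ∧
      p (Sum.inl s) + p (Sum.inr t) = μ s t
  · obtain ⟨s₀, t₀, hs₀, ht₀, h₀⟩ := hex
    refine ⟨LinearMap.proj (Sum.inl s₀), fun d hd hd0 => hred d hd fun s t hs ht hst => ?_⟩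
    replace hd0 : d (Sum.inl s₀) = 0 := hd0
    have e₀ := hpair d hd s₀ t₀ h₀
    have e := hpair d hd s t hst
    rcases h.tight_or_tight hp.1 hs₀ ht₀ hs ht h₀ hst with h' | h'
    all_goals
      have := hpair d hd _ _ h'
      linarith
  · refine ⟨0, fun d hd _ => hred d hd fun s t hs ht hst => ?_⟩
    exact absurd ⟨s, t, hs, ht, hst⟩ hex

/-- The four-point condition bounds the dimension of every face of `T_μ`. -/
lemma FourPointCondition.tightSpanDim_le_one {μ : S → S → ℝ} (h : FourPointCondition μ) :
    tightSpanDim μ ≤ 1 := by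
  refine iSup₂_le fun F hF => ?_
  obtain ⟨hne, hexp, hsub⟩ := hF
  have hconv := hexp.convex (convex_polyhedronP μ)
  -- a point of `F` with fewest tight constraints plays the role of a relative interior point
  obtain ⟨-, ⟨⟨p, hpF, rfl⟩, hmin⟩⟩ :=
    (Set.toFinite (tightConstraints μ '' F)).exists_minimal (hne.image _)
  have htight : ∀ x ∈ F, tightConstraints μ p ⊆ tightConstraints μ x := by
    intro x hx
    have hp' := mem_polyhedronP_iff.1 (hsub hpF).1
    have hx' := mem_polyhedronP_iff.1 (hsub hx).1
    have hm : (2⁻¹ : ℝ) • p + (2⁻¹ : ℝ) • x ∈ F :=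
      hconv hpF hx (by norm_num) (by norm_num) (by norm_num)
    have hmem : ∀ c, c ∈ tightConstraints μ ((2⁻¹ : ℝ) • p + (2⁻¹ : ℝ) • x) →
        c ∈ tightConstraints μ p ∧ c ∈ tightConstraints μ x := by
      intro c hc
      simp only [tightConstraints, Set.mem_ofPred_eq, map_add, map_smul, smul_eq_mul] at hc ⊢
      have h1 := hp' c
      have h2 := hx' c
      constructor <;> linarith
    intro c hc
    exact (hmem c (hmin ⟨_, hm, rfl⟩ (fun c hc => (hmem c hc).1) hc)).2
  obtain ⟨f, hf⟩ := h.exists_functional (hsub hpF)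
  have hdir : ∀ d ∈ vectorSpan ℝ F, ∀ c ∈ tightConstraints μ p, constraintForm c d = 0 := by
    intro d hd c hc
    rw [vectorSpan_eq_span_vsub_set_right ℝ hpF] at hd
    induction hd using Submodule.span_induction with
    | mem d hd =>
      obtain ⟨x, hx, rfl⟩ := hd
      have h1 : constraintForm c p = constraintBound μ c := hc
      have h2 : constraintForm c x = constraintBound μ c := htight x hx hc
      simp [h1, h2]
    | zero => simp
    | add x y _ _ hx hy => rw [map_add, hx, hy, add_zero]
    | smul a x _ hx => rw [map_smul, hx, smul_zero]
  rw [direction_affineSpan]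
  have hinj : Function.Injective (f.comp (vectorSpan ℝ F).subtype) := by
    rw [injective_iff_map_eq_zero]
    intro d hd
    exact Subtype.ext (hf d (hdir d d.2) hd)
  have := LinearMap.finrank_le_finrank_of_injective hinj
  rw [Module.finrank_self] at this
  exact_mod_cast this

/-- If the four-point condition fails at `s, t, u, v`, then the equations `p(s^c) + p(u^r) = μ(s,u)`
and `p(t^c) + p(v^r) = μ(t,v)` are compatible with a two-parameter family of values of `p`.
The family contains an arc of a parabola. Here `A = μ(s,u)`, `B = μ(t,v)`, `C = μ(s,v)`,
`D = μ(t,u)`, and `α + r`, `β + r ^ 2` are the values at `s^c` and `t^c`. -/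
lemma exists_parabola_arc {A B C D : ℝ} (hC : 0 ≤ C) (hD : 0 ≤ D)
    (h : max (C + D) (max A (max C (max D B))) < A + B) :
    ∃ α β ε : ℝ, 0 < ε ∧ ∀ r ∈ Set.Ioo 0 ε, 0 ≤ α + r ∧ α + r ≤ A ∧ 0 ≤ β + r ^ 2 ∧
      β + r ^ 2 ≤ B ∧ C ≤ α + r + (B - (β + r ^ 2)) ∧ D ≤ β + r ^ 2 + (A - (α + r)) := by
  simp only [max_lt_iff] at h
  obtain ⟨h1, h2, h3, h4, h5⟩ := h
  obtain ⟨α, β, hα0, hαA, hβ0, hβB, hαβ, hβα⟩ : ∃ α β : ℝ, 0 < α ∧ α < A ∧ 0 < β ∧ β < B ∧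
      C < α + (B - β) ∧ D < β + (A - α) := by
    -- the conditions on `α - β` leave the interval from `C - B` to `A - D`, with midpoint `δ`
    set δ := ((C - B) + (A - D)) / 2 with hδ
    set η := min (A - max δ 0) (B - max (-δ) 0) / 2 with hη
    have m1 : max δ 0 < A := max_lt (by linarith) (by linarith)
    have m2 : max (-δ) 0 < B := max_lt (by linarith) (by linarith)
    have hη0 : 0 < η := half_pos (lt_min (by linarith) (by linarith))
    have hη1 : 2 * η ≤ A - max δ 0 := by
      rw [hη, mul_div_cancel₀ _ two_ne_zero]
      exact min_le_left _ _
    have hη2 : 2 * η ≤ B - max (-δ) 0 := by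
      rw [hη, mul_div_cancel₀ _ two_ne_zero]
      exact min_le_right _ _
    have hsub : max δ 0 - max (-δ) 0 = δ := by
      rcases le_total δ 0 with h | h
      · rw [max_eq_right h, max_eq_left (by linarith)]; ring
      · rw [max_eq_left h, max_eq_right (by linarith)]; ring
    have := le_max_right δ 0
    have := le_max_right (-δ) 0
    exact ⟨max δ 0 + η, max (-δ) 0 + η, by linarith, by linarith, by linarith, by linarith,
      by linarith, by linarith⟩
  have key : ∀ᶠ r : ℝ in 𝓝 0, 0 < α + r ∧ α + r < A ∧ 0 < β + r ^ 2 ∧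
      β + r ^ 2 < B ∧ C < α + r + (B - (β + r ^ 2)) ∧ D < β + r ^ 2 + (A - (α + r)) := by
    have ev : ∀ {f g : ℝ → ℝ}, Continuous f → Continuous g → f 0 < g 0 →
        ∀ᶠ r in 𝓝 0, f r < g r := fun hf hg h0 =>
      (isOpen_lt hf hg).mem_nhds h0
    refine (ev ?_ ?_ ?_).and <| (ev ?_ ?_ ?_).and <| (ev ?_ ?_ ?_).and <| (ev ?_ ?_ ?_).and <|
      (ev ?_ ?_ ?_).and (ev ?_ ?_ ?_) <;> first | fun_prop | simpa
  obtain ⟨ε, hε, hsub⟩ :=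
    mem_nhdsGT_iff_exists_Ioo_subset.1 (nhdsWithin_le_nhds (s := Set.Ioi 0) key)
  refine ⟨α, β, ε, hε, fun r hr => ?_⟩
  obtain ⟨k1, k2, k3, k4, k5, k6⟩ := hsub hr
  exact ⟨k1.le, k2.le, k3.le, k4.le, k5.le, k6.le⟩

/-- Prescribed values at four coordinates `s^c, t^c, u^r, v^r` with `p(s^c) + p(u^r) = μ(s,u)` and
`p(t^c) + p(v^r) = μ(t,v)` extend to a point of `T_μ`. -/
lemma exists_mem_tightSpan_of_four_points {μ : S → S → ℝ} {s t u v : S}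
    (hst : s ≠ t) (huv : u ≠ v) {a b : ℝ} (ha : 0 ≤ a) (ha' : a ≤ μ s u) (hb : 0 ≤ b)
    (hb' : b ≤ μ t v) (hsv : μ s v ≤ a + (μ t v - b)) (htu : μ t u ≤ b + (μ s u - a)) :
    ∃ p ∈ tightSpan μ, p (Sum.inl s) = a ∧ p (Sum.inl t) = b := by
  classical
  obtain ⟨M, hM⟩ : ∃ M, ∀ e : S × S, μ e.1 e.2 ≤ M := by
    obtain ⟨M, hM⟩ := (Set.finite_range fun e : S × S => μ e.1 e.2).bddAbove
    exact ⟨M, fun e => hM ⟨e, rfl⟩⟩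
  have hM0 : 0 ≤ M := ha.trans (ha'.trans (hM (s, u)))
  -- a point of `P_μ` with the prescribed values; a point of `T_μ` below it keeps them, because the
  -- two equations leave no room to lower the four coordinates
  set q : S ⊕ S → ℝ := Sum.elim (fun x => if x = s then a else if x = t then b else M)
    (fun y => if y = u then μ s u - a else if y = v then μ t v - b else M) with hq
  have hqP : q ∈ polyhedronP μ := by
    have q0 : ∀ w, 0 ≤ q w := by
      rintro (x | y) <;> simp only [hq, Sum.elim_inl, Sum.elim_inr] <;> split_ifs <;> linarith
    refine ⟨fun x y => ?_, q0⟩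
    by_cases hx : x = s ∨ x = t
    swap
    · have e : q (Sum.inl x) = M := by simp [hq, not_or.1 hx]
      linarith [q0 (Sum.inr y), hM (x, y)]
    by_cases hy : y = u ∨ y = v
    swap
    · have e : q (Sum.inr y) = M := by simp [hq, not_or.1 hy]
      linarith [q0 (Sum.inl x), hM (x, y)]
    rcases hx with rfl | rfl <;> rcases hy with rfl | rfl <;>
      simp [hq, hst.symm, huv.symm] <;> linarith
  obtain ⟨p, hp, hpq⟩ := exists_mem_tightSpan_le hqP
  have e1 := hpq (Sum.inl s)
  have e2 := hpq (Sum.inl t)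
  have e3 := hpq (Sum.inr u)
  have e4 := hpq (Sum.inr v)
  simp [hq, hst.symm, huv.symm] at e1 e2 e3 e4
  have e5 := hp.1.1 s u
  have e6 := hp.1.1 t v
  exact ⟨p, hp, by linarith, by linarith⟩

/-- If all faces of `T_μ` are at most one-dimensional, the four-point condition holds. Otherwise the
points of an arc of a parabola lift to `T_μ`; infinitely many of the lifts lie on one of the
finitely many faces, hence on a line, but no three points of a parabola are collinear. -/
lemma fourPointCondition_of_tightSpanDim_le_one {μ : S → S → ℝ} (hμ : IsDirectedDistance μ)
    (hdim : tightSpanDim μ ≤ 1) : FourPointCondition μ := by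
  intro s t u v
  by_contra! hlt
  obtain ⟨α, β, ε, hε, harc⟩ := exists_parabola_arc (hμ.nonneg s v) (hμ.nonneg t u) hlt
  have hlt' := (max_lt_iff.1 hlt).1
  have hst : s ≠ t := by
    rintro rfl
    linarith
  have huv : u ≠ v := by
    rintro rfl
    linarith
  have hlift : ∀ r : Set.Ioo 0 ε, ∃ p ∈ tightSpan μ,
      p (Sum.inl s) = α + r ∧ p (Sum.inl t) = β + (r : ℝ) ^ 2 := fun r => by
    obtain ⟨k1, k2, k3, k4, k5, k6⟩ := harc r r.2
    exact exists_mem_tightSpan_of_four_points hst huv k1 k2 k3 k4 k5 k6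
  choose p hp hps hpt using hlift
  have : Infinite (Set.Ioo 0 ε) := (Set.Ioo_infinite hε).to_subtype
  obtain ⟨σ, hσ⟩ := Finite.exists_infinite_fiber fun r => tightConstraints μ (p r)
  obtain ⟨r₁⟩ := hσ.nonempty
  obtain ⟨r₂, h₂⟩ := Infinite.exists_notMem_finset {r₁}
  obtain ⟨r₃, h₃⟩ := Infinite.exists_notMem_finset {r₁, r₂}
  simp only [Finset.mem_singleton, Finset.mem_insert, not_or] at h₂ h₃
  obtain ⟨r₁, rfl⟩ := r₁
  obtain ⟨r₂, hr₂⟩ := r₂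
  obtain ⟨r₃, hr₃⟩ := r₃
  simp only [Subtype.mk.injEq, Set.mem_preimage, Set.mem_singleton_iff] at h₂ h₃ hr₂ hr₃
  set F := {x ∈ polyhedronP μ | tightConstraints μ (p r₁) ⊆ tightConstraints μ x}
  have hF : Module.finrank ℝ (vectorSpan ℝ F) ≤ 1 := by
    rw [← direction_affineSpan]
    exact_mod_cast (iSup₂_le_iff.1 hdim) F
      (setOf_tightConstraints_subset_mem_tightSpanFaces (hp r₁))
  have hF₁ : p r₁ ∈ F := ⟨(hp r₁).1, subset_rfl⟩
  have hF₂ : p r₂ ∈ F := ⟨(hp r₂).1, hr₂.ge⟩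
  have hF₃ : p r₃ ∈ F := ⟨(hp r₃).1, hr₃.ge⟩
  obtain ⟨w, hw⟩ := finrank_le_one_iff.1 hF
  obtain ⟨c₂, hc₂⟩ := hw ⟨_, vsub_mem_vectorSpan ℝ hF₂ hF₁⟩
  obtain ⟨c₃, hc₃⟩ := hw ⟨_, vsub_mem_vectorSpan ℝ hF₃ hF₁⟩
  replace hc₂ := congrArg Subtype.val hc₂
  replace hc₃ := congrArg Subtype.val hc₃
  have s₂ := congrFun hc₂ (Sum.inl s)
  have t₂ := congrFun hc₂ (Sum.inl t)
  have s₃ := congrFun hc₃ (Sum.inl s)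
  have t₃ := congrFun hc₃ (Sum.inl t)
  simp [hps, hpt] at s₂ t₂ s₃ t₃
  have hprod : ((r₂ : ℝ) - r₁) * ((r₃ : ℝ) - r₁) * ((r₃ : ℝ) - r₂) = 0 := by
    have : ((r₂ : ℝ) - r₁) * ((r₃ : ℝ) ^ 2 - (r₁ : ℝ) ^ 2) =
        ((r₂ : ℝ) ^ 2 - (r₁ : ℝ) ^ 2) * ((r₃ : ℝ) - r₁) := by
      rw [← s₂, ← t₂, ← s₃, ← t₃]
      ring
    linear_combination this
  rcases mul_eq_zero.1 hprod with h | h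
  · rcases mul_eq_zero.1 h with h | h
    · exact h₂ (Subtype.ext (Subtype.ext (sub_eq_zero.1 h)))
    · exact h₃.1 (Subtype.ext (Subtype.ext (sub_eq_zero.1 h)))
  · exact h₃.2 (Subtype.ext (sub_eq_zero.1 h))

end TightSpan

/-! ### Directed metrics of directed paths -/

namespace OrientedTree

variable {V : Type*} (Γ : OrientedTree V)

lemma underlying_adj {x y : V} :
    Γ.underlying.Adj x y ↔ Γ.graph.Adj x y ∨ Γ.graph.Adj y x := by
  refine ⟨fun h => h.2, fun h => ⟨?_, h⟩⟩
  rintro rfl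
  rcases h with h | h <;> exact Γ.asymm _ _ h h

lemma path_isPath (x y : V) : (Γ.path x y).IsPath :=
  (Γ.isTree.existsUnique_path x y).choose_spec.1

lemma eq_path {x y : V} {p : Γ.underlying.Walk x y} (hp : p.IsPath) : p = Γ.path x y :=
  (Γ.isTree.existsUnique_path x y).choose_spec.2 p hp

/-- A function on the vertices whose increment along every edge is the length of the edge. -/
def IsPotential (α : V → V → ℝ) (φ : V → ℝ) : Prop :=
  ∀ x y, Γ.graph.Adj x y → φ y = φ x + α x y

/-- On a tree, signed lengths can be summed up along the paths from a fixed root. -/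
lemma exists_isPotential (α : V → V → ℝ) : ∃ φ, Γ.IsPotential α φ := by
  classical
  obtain ⟨r⟩ := Γ.isTree.connected.nonempty
  let w : V → V → ℝ := fun x y =>
    if Γ.graph.Adj x y then α x y else if Γ.graph.Adj y x then -α y x else 0
  refine ⟨fun y => ((Γ.path r y).darts.map fun e => w e.fst e.snd).sum, fun x y hxy => ?_⟩
  have hadj : Γ.underlying.Adj x y := Γ.underlying_adj.2 (Or.inl hxy)
  have hw : w x y = α x y := if_pos hxy
  have hw' : w y x = -α x y := (if_neg (Γ.asymm x y hxy)).trans (if_pos hxy)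
  by_cases hx : x ∈ (Γ.path r y).support
  · have := Γ.isTree.isAcyclic.path_concat (Γ.path_isPath r x) (Γ.path_isPath r y) hadj hx
    simp [this, SimpleGraph.Walk.darts_concat, hw]
  · have := Γ.eq_path ((Γ.path_isPath r y).concat hx hadj.symm)
    simp [← this, SimpleGraph.Walk.darts_concat, hw']

variable {Γ}

/-- In a directed path, a path of the underlying tree never changes direction. -/
lemma IsDirectedPath.forward_or_backward (hΓ : Γ.IsDirectedPath) {x y : V}
    (p : Γ.underlying.Walk x y) (hp : p.IsPath) :
    (∀ e ∈ p.darts, Γ.graph.Adj e.fst e.snd) ∨ ∀ e ∈ p.darts, Γ.graph.Adj e.snd e.fst := by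
  induction p with
  | nil => simp
  | @cons a b c h p ih =>
    rw [SimpleGraph.Walk.cons_isPath_iff] at hp
    cases p with
    | nil => simpa using Γ.underlying_adj.1 h
    | @cons _ d _ h' p =>
      have had : a ≠ d := by
        rintro rfl
        simp at hp
      rcases Γ.underlying_adj.1 h with hab | hba
      · refine Or.inl ?_
        rcases ih hp.1 with hf | hb
        · simp only [SimpleGraph.Walk.darts_cons, List.forall_mem_cons] at hf ⊢
          exact ⟨hab, hf⟩
        · exact absurd (hΓ.2 _ _ _ hab (hb ⟨(b, d), h'⟩ (by simp))) had
      · refine Or.inr ?_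
        rcases ih hp.1 with hf | hb
        · exact absurd (hΓ.1 _ _ _ hba (hf ⟨(b, d), h'⟩ (by simp))) had
        · simp only [SimpleGraph.Walk.darts_cons, List.forall_mem_cons] at hb ⊢
          exact ⟨hba, hb⟩

open Classical in
/-- The directed metric of a directed path is the positive part of the increment of a potential. -/
lemma IsDirectedPath.dist_eq (hΓ : Γ.IsDirectedPath) {α : V → V → ℝ}
    (hα : ∀ x y, Γ.graph.Adj x y → 0 < α x y) {φ : V → ℝ} (hφ : Γ.IsPotential α φ) (x y : V) :
    Γ.dist α x y = max 0 (φ y - φ x) := by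
  have hforward : ∀ {x y : V} (p : Γ.underlying.Walk x y),
      (∀ e ∈ p.darts, Γ.graph.Adj e.fst e.snd) →
      φ x ≤ φ y ∧ (p.darts.map fun e =>
        if Γ.graph.Adj e.fst e.snd then α e.fst e.snd else 0).sum = φ y - φ x := by
    intro x y p
    induction p with
    | nil => simp
    | @cons a b c h p ih =>
      intro hp
      simp only [SimpleGraph.Walk.darts_cons, List.forall_mem_cons] at hp
      obtain ⟨h1, h2⟩ := ih hp.2
      have h3 := hφ a b hp.1
      have h4 := hα a b hp.1
      rw [SimpleGraph.Walk.darts_cons, List.map_cons, List.sum_cons, h2, if_pos hp.1]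
      constructor <;> linarith
  have hbackward : ∀ {x y : V} (p : Γ.underlying.Walk x y),
      (∀ e ∈ p.darts, Γ.graph.Adj e.snd e.fst) →
      φ y ≤ φ x ∧ (p.darts.map fun e =>
        if Γ.graph.Adj e.fst e.snd then α e.fst e.snd else 0).sum = 0 := by
    intro x y p
    induction p with
    | nil => simp
    | @cons a b c h p ih =>
      intro hp
      simp only [SimpleGraph.Walk.darts_cons, List.forall_mem_cons] at hp
      obtain ⟨h1, h2⟩ := ih hp.2
      have h3 := hφ b a hp.1
      have h4 := hα b a hp.1
      rw [SimpleGraph.Walk.darts_cons, List.map_cons, List.sum_cons, h2,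
        if_neg (Γ.asymm b a hp.1)]
      constructor <;> linarith
  rcases hΓ.forward_or_backward _ (Γ.path_isPath x y) with h | h
  · obtain ⟨h1, h2⟩ := hforward _ h
    rw [max_eq_right (sub_nonneg.2 h1)]
    exact h2
  · obtain ⟨h1, h2⟩ := hbackward _ h
    rw [max_eq_left (sub_nonpos.2 h1)]
    exact h2

variable (Γ) in
lemma dist_nonneg {α : V → V → ℝ} (hα : ∀ x y, Γ.graph.Adj x y → 0 < α x y) (x y : V) :
    0 ≤ Γ.dist α x y := by
  refine List.sum_nonneg fun r hr => ?_
  obtain ⟨e, -, rfl⟩ := List.mem_map.1 hr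
  split_ifs with h
  · exact (hα _ _ h).le
  · exact le_rfl

variable (Γ) in
lemma exists_setDist_eq [Finite V] (α : V → V → ℝ) {A B : Set V} (hA : A.Nonempty)
    (hB : B.Nonempty) : ∃ x ∈ A, ∃ y ∈ B, Γ.setDist α A B = Γ.dist α x y := by
  have hfin : {r | ∃ x ∈ A, ∃ y ∈ B, r = Γ.dist α x y}.Finite :=
    (Set.finite_range fun e : V × V => Γ.dist α e.1 e.2).subset <| by
      rintro r ⟨x, -, y, -, rfl⟩
      exact ⟨(x, y), rfl⟩
  obtain ⟨x, hx⟩ := hA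
  obtain ⟨y, hy⟩ := hB
  have hne : {r | ∃ x ∈ A, ∃ y ∈ B, r = Γ.dist α x y}.Nonempty := ⟨_, x, hx, y, hy, rfl⟩
  exact hne.csInf_mem hfin

variable (Γ) in
lemma setDist_le {α : V → V → ℝ} (hα : ∀ x y, Γ.graph.Adj x y → 0 < α x y) {A B : Set V} {x y : V}
    (hx : x ∈ A) (hy : y ∈ B) : Γ.setDist α A B ≤ Γ.dist α x y :=
  csInf_le ⟨0, by rintro r ⟨x, -, y, -, rfl⟩; exact Γ.dist_nonneg hα x y⟩ ⟨x, hx, y, hy, rfl⟩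

end OrientedTree

/-- A directed distance realized by a directed path satisfies the four-point condition. If
`μ(s,u)` and `μ(t,v)` are positive and `(x, y')`, `(x', y)` attain `μ(s,v)`, `μ(t,u)`, then
`μ(s,u) ≤ φ y - φ x` and `μ(t,v) ≤ φ y' - φ x'`, and the sum of the two bounds can be regrouped. -/
lemma OrientedTreeRealization.fourPointCondition {S V : Type*} [Finite V] {μ : S → S → ℝ}
    (hμ : IsDirectedDistance μ) (R : OrientedTreeRealization μ V) (hR : R.tree.IsDirectedPath) :
    FourPointCondition μ := by
  intro s t u v
  rcases (hμ.nonneg s u).eq_or_lt with h0 | hsu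
  · rw [← h0, zero_add]
    simp
  rcases (hμ.nonneg t v).eq_or_lt with h0 | htv
  · rw [← h0, add_zero]
    simp
  refine le_max_of_le_left ?_
  obtain ⟨φ, hφ⟩ := R.tree.exists_isPotential R.len
  have hdist := hR.dist_eq R.len_pos hφ
  obtain ⟨x, hx, y', hy', e₁⟩ := R.tree.exists_setDist_eq R.len (R.connected s).nonempty
    (R.connected v).nonempty
  obtain ⟨x', hx', y, hy, e₂⟩ := R.tree.exists_setDist_eq R.len (R.connected t).nonempty
    (R.connected u).nonempty
  have l₁ := R.tree.setDist_le R.len_pos hx hy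
  have l₂ := R.tree.setDist_le R.len_pos hx' hy'
  rw [← R.realizes, hdist] at e₁ e₂ l₁ l₂
  have l₁' := (le_max_iff.1 l₁).resolve_left hsu.not_ge
  have l₂' := (le_max_iff.1 l₂).resolve_left htv.not_ge
  have g₁ := le_max_right 0 (φ y' - φ x)
  have g₂ := le_max_right 0 (φ y - φ x')
  linarith

/-! ### Realization by intervals of a finite chain -/

section Chain

variable {V : Type*} [LinearOrder V]

/-- The covering relation of a linear order as a directed graph. -/
def chainGraph (V : Type*) [LinearOrder V] : Digraph V where
  Adj x y := x ⋖ y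

lemma chainGraph_adj {x y : V} : (chainGraph V).Adj x y ↔ x ⋖ y := Iff.rfl

lemma chainGraph_underlying_adj {x y : V} :
    (chainGraph V).toSimpleGraphInclusive.Adj x y ↔ x ⋖ y ∨ y ⋖ x :=
  ⟨fun h => h.2, fun h => ⟨h.elim CovBy.ne CovBy.ne', h⟩⟩

variable [Finite V]

/-- Intervals of a finite chain are connected: one can descend to the least element. -/
lemma chainGraph_induce_Icc_connected {a b : V} (hab : a ≤ b) :
    ((⊤ : (chainGraph V).toSimpleGraphInclusive.Subgraph).induce (Set.Icc a b)).Connected := by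
  set H := (⊤ : (chainGraph V).toSimpleGraphInclusive.Subgraph).induce (Set.Icc a b) with hH
  have key : ∀ x : V, ∀ hx : x ∈ Set.Icc a b,
      H.coe.Reachable ⟨a, le_rfl, hab⟩ ⟨x, hx⟩ := by
    intro x
    induction x using WellFoundedLT.induction with
    | ind x ih =>
      intro hx
      rcases hx.1.eq_or_lt with rfl | hlt
      · exact SimpleGraph.Reachable.refl _
      · obtain ⟨c, hac, hcx⟩ := exists_le_covBy_of_lt hlt
        have hc : c ∈ Set.Icc a b := ⟨hac, hcx.le.trans hx.2⟩
        refine (ih c hcx.lt hc).trans (SimpleGraph.Adj.reachable ?_)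
        exact ⟨hc, hx, chainGraph_underlying_adj.2 (Or.inl hcx)⟩
  have : Nonempty H.verts := ⟨⟨a, le_rfl, hab⟩⟩
  exact ⟨⟨fun x y => (key x x.2).symm.trans (key y y.2)⟩⟩

/-- Every edge of a finite chain is a bridge: it separates the elements below it from those above
it. -/
lemma chainGraph_isTree [Nonempty V] : (chainGraph V).toSimpleGraphInclusive.IsTree := by
  refine ⟨⟨fun x y => ?_⟩, ?_⟩
  · have hle : ∀ {x y : V}, x ≤ y → (chainGraph V).toSimpleGraphInclusive.Reachable x y := by
      intro x y hxy
      have h := (chainGraph_induce_Icc_connected hxy).coe.preconnected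
        ⟨x, le_rfl, hxy⟩ ⟨y, hxy, le_rfl⟩
      exact h.map (SimpleGraph.Subgraph.hom _)
    rcases le_total x y with h | h
    · exact hle h
    · exact (hle h).symm
  · have hbridge : ∀ {x y : V}, x ⋖ y →
        (chainGraph V).toSimpleGraphInclusive.IsBridge s(x, y) := by
      intro x y hxy
      rw [SimpleGraph.isBridge_iff]
      rintro ⟨p⟩
      have hside : ∀ {a b : V}, ((chainGraph V).toSimpleGraphInclusive.deleteEdges
          {s(x, y)}).Walk a b → a ≤ x → b ≤ x := by
        intro a b p
        induction p with
        | nil => exact id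
        | @cons a b c h p ih =>
          intro ha
          rw [SimpleGraph.deleteEdges_adj] at h
          refine ih ?_
          rcases chainGraph_underlying_adj.1 h.1 with hab | hba
          · rcases ha.eq_or_lt with rfl | hlt
            · exact absurd (by rw [hab.unique_right hxy]; rfl) h.2
            · exact hab.ge_of_gt hlt
          · exact hba.le.trans ha
      exact (hside p le_rfl).not_gt hxy.lt
    rw [SimpleGraph.isAcyclic_iff_forall_adj_isBridge]
    intro x y hxy
    rcases chainGraph_underlying_adj.1 hxy with h | h
    · exact hbridge h
    · rw [Sym2.eq_swap]
      exact hbridge h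

/-- A nonempty finite chain as an oriented tree. -/
def chainTree (V : Type*) [LinearOrder V] [Finite V] [Nonempty V] : OrientedTree V where
  graph := chainGraph V
  asymm _ _ h h' := lt_asymm (chainGraph_adj.1 h).lt (chainGraph_adj.1 h').lt
  isTree := chainGraph_isTree

lemma chainTree_isDirectedPath [Nonempty V] : (chainTree V).IsDirectedPath :=
  ⟨fun _ _ _ h h' => CovBy.unique_right h h', fun _ _ _ h h' => CovBy.unique_left h h'⟩

end Chain

/-- A family of intervals `[a s, b s]` of the real line realizes the directed distance
`(s, t) ↦ max 0 (a t - b s)` on the directed path formed by the end points. -/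
lemma exists_realization_of_intervals {S : Type*} [Finite S] {μ : S → S → ℝ} {a b : S → ℝ}
    (hab : ∀ s, a s ≤ b s) (h : ∀ s t, μ s t = max 0 (a t - b s)) :
    ∃ (V : Type) (_ : Finite V) (R : OrientedTreeRealization μ V), R.tree.IsDirectedPath := by
  -- the point `0` keeps the vertex set nonempty when `S` is empty
  let X : Set ℝ := insert 0 (Set.range a ∪ Set.range b)
  have hX : Finite X := (((Set.finite_range a).union (Set.finite_range b)).insert 0).to_subtype
  have : Nonempty X := ⟨⟨0, Set.mem_insert _ _⟩⟩
  let a' : S → X := fun s => ⟨a s, Or.inr (Or.inl ⟨s, rfl⟩)⟩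
  let b' : S → X := fun s => ⟨b s, Or.inr (Or.inr ⟨s, rfl⟩)⟩
  have hab' : ∀ s, a' s ≤ b' s := hab
  have hpos : ∀ x y : X, (chainTree X).graph.Adj x y → 0 < (y : ℝ) - x :=
    fun x y hxy => sub_pos.2 (chainGraph_adj.1 hxy).lt
  have hpot : (chainTree X).IsPotential (fun x y => (y : ℝ) - x) (fun x => (x : ℝ)) :=
    fun x y _ => (add_sub_cancel _ _).symm
  have hdist := chainTree_isDirectedPath.dist_eq hpos hpot
  refine ⟨X, hX, ⟨chainTree X, fun x y => (y : ℝ) - x, hpos,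
    fun s => (⊤ : (chainTree X).underlying.Subgraph).induce (Set.Icc (a' s) (b' s)),
    fun s => chainGraph_induce_Icc_connected (hab' s), fun s t => ?_⟩, chainTree_isDirectedPath⟩
  rw [OrientedTree.setDist]
  symm
  apply IsLeast.csInf_eq
  constructor
  · refine ⟨b' s, ⟨hab' s, le_rfl⟩, a' t, ⟨le_rfl, hab' t⟩, ?_⟩
    rw [h, hdist]
  · rintro r ⟨x, hx, y, hy, rfl⟩
    rw [h, hdist]
    have h1 : (x : ℝ) ≤ b s := hx.2
    have h2 : a t ≤ y := hy.1
    exact max_le_max le_rfl (by linarith)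

/-- Under the four-point condition, `μ` is the distance between the intervals with end points
`a t = μ(s₀, t)` and `b s = μ(s₀, u₀) - μ(s, u₀)`, where `(s₀, u₀)` maximizes `μ`. -/
lemma FourPointCondition.exists_intervals {S : Type*} [Finite S] {μ : S → S → ℝ}
    (h : FourPointCondition μ) (hμ : IsDirectedDistance μ) :
    ∃ a b : S → ℝ, (∀ s, a s ≤ b s) ∧ ∀ s t, μ s t = max 0 (a t - b s) := by
  rcases isEmpty_or_nonempty S with hS | hS
  · exact ⟨0, 0, fun s => hS.elim s, fun s => hS.elim s⟩
  obtain ⟨⟨s₀, u₀⟩, hmax⟩ := Finite.exists_max fun e : S × S => μ e.1 e.2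
  replace hmax : ∀ s t, μ s t ≤ μ s₀ u₀ := fun s t => hmax (s, t)
  have key : ∀ s t, μ s t = max 0 (μ s₀ t - (μ s₀ u₀ - μ s u₀)) := by
    intro t v
    apply le_antisymm
    · rcases (hμ.nonneg t v).eq_or_lt with h0 | hpos
      · rw [← h0]
        exact le_max_left _ _
      · refine le_max_of_le_right ?_
        rcases le_max_iff.1 (h s₀ t u₀ v) with h1 | h1
        · linarith
        · have : max (μ s₀ u₀) (max (μ s₀ v) (max (μ t u₀) (μ t v))) ≤ μ s₀ u₀ := by
            simp [hmax]
          linarith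
    · refine max_le (hμ.nonneg t v) ?_
      rcases le_max_iff.1 (h s₀ t v u₀) with h1 | h1
      · linarith
      · have : max (μ s₀ v) (max (μ s₀ u₀) (max (μ t v) (μ t u₀))) ≤ μ s₀ u₀ := by
          simp [hmax]
        linarith [hμ.nonneg t v]
  refine ⟨fun t => μ s₀ t, fun s => μ s₀ u₀ - μ s u₀, fun s => ?_, key⟩
  -- the diagonal entry `μ(s, s) = 0` makes the interval of `s` nonempty
  have h1 := key s s
  rw [hμ.diag] at h1
  exact sub_nonpos.1 (max_eq_left_iff.1 h1.symm)

end DirectedDistance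

theorem mainTheorem4 {S : Type*} [Finite S] (μ : S → S → ℝ) (hμ : IsDirectedDistance μ) :
    List.TFAE
      [∃ (V : Type) (_ : Finite V) (R : DirectedDistance.OrientedTreeRealization μ V),
          R.tree.IsDirectedPath,
        DirectedDistance.tightSpanDim μ ≤ 1,
        ∀ s t u v : S, μ s u + μ t v ≤
          max (μ s v + μ t u) (max (μ s u) (max (μ s v) (max (μ t u) (μ t v))))] := by
  tfae_have 1 → 3 := fun ⟨_, _, R, hR⟩ => R.fourPointCondition hμ hR
  tfae_have 3 → 1 := fun h => by
    obtain ⟨a, b, hab, hμab⟩ := DirectedDistance.FourPointCondition.exists_intervals h hμ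
    exact DirectedDistance.exists_realization_of_intervals hab hμab
  tfae_have 3 → 2 := DirectedDistance.FourPointCondition.tightSpanDim_le_one
  tfae_have 2 → 3 := DirectedDistance.fourPointCondition_of_tightSpanDim_le_one hμ
  tfae_finish
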